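/- A real sequence $(G_n)_{n\ge 1}$ in $L^2[0,1]$ is an orthonormal system (ONS) on $[0,1]$ if $\int_0^1 G_m(u)G_n(u)\,du$ equals $1$ for $m=n$ and $0$ for $m\ne n$. For a function $f$ on $[0,1]$ put $$C_n(f,G)=\int_0^1 f(u)G_n(u)\,du,\qquad S_n(x,f,G)=\sum_{k=1}^n C_k(f,G)\,G_k(x).$$ Let $C_L$ be the class of functions $f:[0,1]\to\mathbb R$ that are differentiable on $[0,1]$ (one-sidedly at the end points) with derivative $f'$ Lipschitz on $[0,1]$. **Theorem.** There exist a function $g\in C_L$ and an ONS $(G_n)$ on $[0,1]$ such that $$\int_0^1 G_n(u)\,du=0\quad\text{and}\quad \int_0^1 u\,G_n(u)\,du=0\qquad (n=1,2,\dots)$$ and $$\limsup_{n\to\infty}|S_n(x,g,G)|=+\infty\quad\text{for almost every }x\in[0,1].$$ In particular, for $q(u)=1$ and $p(u)=u$ one has $S_n(x,q,G)=O(1)$ and $S_n(x,p,G)=O(1)$ as $n\to\infty$ at every $x\in[0,1]$, so boundedness of the partial sums of $p$ and $q$ alone does not guarantee boundedness of the partial sums of every function of $C_L$. -/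

import Mathlib

open MeasureTheory Filter Set
open scoped Topology

/-- `φ` is an orthonormal system (ONS) of real functions in `L²[0,1]`. The system is indexed from
`0`, so `φ 0, φ 1, …` stand for `φ₁, φ₂, …`. -/
structure IsONS (φ : ℕ → ℝ → ℝ) : Prop where
  memLp : ∀ n, MemLp (φ n) 2 (volume.restrict (Icc (0 : ℝ) 1))
  orthonormal : ∀ m n, ∫ x in (0 : ℝ)..1, φ m x * φ n x = if m = n then 1 else 0

/-- The class `Lip 1` on `[0,1]`. -/
def IsLip1 (f : ℝ → ℝ) : Prop :=
  ∃ K : NNReal, LipschitzOnWith K f (Icc (0 : ℝ) 1)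

/-- The class `C_L`: `f` is differentiable on `[0,1]` (one-sidedly at the end points) and its
derivative belongs to `Lip 1`. -/
def IsCL (f : ℝ → ℝ) : Prop :=
  DifferentiableOn ℝ f (Icc (0 : ℝ) 1) ∧ IsLip1 (derivWithin f (Icc (0 : ℝ) 1))

/-- The Fourier coefficient `C_n(f) = ∫₀¹ f φ_n` of `f` with respect to `φ`. -/
noncomputable def fourierCoefficient (φ : ℕ → ℝ → ℝ) (f : ℝ → ℝ) (n : ℕ) : ℝ :=
  ∫ u in (0 : ℝ)..1, f u * φ n u

/-- The Fourier partial sum `S_n(x, f)`: the sum of the first `n` terms `C_k(f) φ_k(x)`. -/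
noncomputable def fourierPartialSum (φ : ℕ → ℝ → ℝ) (f : ℝ → ℝ) (n : ℕ) (x : ℝ) : ℝ :=
  ∑ k ∈ Finset.range n, fourierCoefficient φ f k * φ k x

/-- `f` belongs to `E(φ)` at the point `x`: the partial sums satisfy `|S_n(x, f)| = O(1)`. -/
def MemE (φ : ℕ → ℝ → ℝ) (x : ℝ) (f : ℝ → ℝ) : Prop :=
  (fun n => fourierPartialSum φ f n x) =O[atTop] (fun _ => (1 : ℝ))

/-! Take g(u) = u². It suffices to build orthogonal step functions, orthogonal to 1 and u, whose
Fourier sums of u² are unbounded at every point; normalising does not change Fourier terms.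

The divergence comes from ordering Haar functions by midpoint. Each x meets one ±1 value in each of
n generations, and those where x lies in the right half (+1) precede those where it lies in the left
half (-1). With R positive values, some partial sum at x is R and the full sum is 2R - n; one of the
two has order n, although the full sum f has L² norm only √n (`exists_prefix_haarTree`,
`sum_ip_haarTree`). Turning f/√n through a fixed angle towards the constant 1 is isometric on the
Haar span (`ip_rotate`) and gives every rotated function a mean proportional to its squared norm
over √n. So the Fourier sums of 1 are, up to bounded corrections, Haar sums divided by √n, and reach
order √n at every point.

Alternating twice kills the moments of order 0 and 1 and moves the mean into the second moment.
Compression then makes a block orthogonal to all earlier step functions, at the price of a factor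
that a larger n repays (`exists_orthogonal_partialSums_sq_large`). Concatenating blocks with growing
targets gives the system. -/

/-! ### Periodic dyadic step functions -/

/-- The function whose restrictions to the two halves of the unit period are compressed copies of
`a` and `b`. -/
noncomputable def glue (a b : ℝ → ℝ) (x : ℝ) : ℝ :=
  if Int.fract x < 1 / 2 then a (2 * x) else b (2 * x)

/-- `1`-periodic functions that are constant on the dyadic intervals of length `2⁻ᵐ`. -/
def IsStep : ℕ → (ℝ → ℝ) → Prop
  | 0, f => ∃ c : ℝ, f = fun _ => c
  | m + 1, f => ∃ a b, IsStep m a ∧ IsStep m b ∧ f = glue a b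

theorem glue_add (a b c d : ℝ → ℝ) : glue a b + glue c d = glue (a + c) (b + d) := by
  funext x; simp only [glue, Pi.add_apply]; split_ifs <;> rfl

theorem glue_mul (a b c d : ℝ → ℝ) : glue a b * glue c d = glue (a * c) (b * d) := by
  funext x; simp only [glue, Pi.mul_apply]; split_ifs <;> rfl

theorem glue_const (c : ℝ) : glue (fun _ => c) (fun _ => c) = fun _ => c := by
  funext x; simp [glue]

namespace IsStep

theorem const (m : ℕ) (c : ℝ) : IsStep m (fun _ => c) := by
  induction m with
  | zero => exact ⟨c, rfl⟩
  | succ m ih => exact ⟨_, _, ih, ih, (glue_const c).symm⟩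

theorem add {m : ℕ} {f g : ℝ → ℝ} (hf : IsStep m f) (hg : IsStep m g) : IsStep m (f + g) := by
  induction m generalizing f g with
  | zero =>
    obtain ⟨c, rfl⟩ := hf
    obtain ⟨d, rfl⟩ := hg
    exact ⟨c + d, rfl⟩
  | succ m ih =>
    obtain ⟨a, b, ha, hb, rfl⟩ := hf
    obtain ⟨c, d, hc, hd, rfl⟩ := hg
    exact ⟨_, _, ih ha hc, ih hb hd, glue_add _ _ _ _⟩

theorem mul {m : ℕ} {f g : ℝ → ℝ} (hf : IsStep m f) (hg : IsStep m g) : IsStep m (f * g) := by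
  induction m generalizing f g with
  | zero =>
    obtain ⟨c, rfl⟩ := hf
    obtain ⟨d, rfl⟩ := hg
    exact ⟨c * d, rfl⟩
  | succ m ih =>
    obtain ⟨a, b, ha, hb, rfl⟩ := hf
    obtain ⟨c, d, hc, hd, rfl⟩ := hg
    exact ⟨_, _, ih ha hc, ih hb hd, glue_mul _ _ _ _⟩

theorem smul {m : ℕ} {f : ℝ → ℝ} (r : ℝ) (hf : IsStep m f) : IsStep m (r • f) :=
  (const m r).mul hf

theorem succ {m : ℕ} {f : ℝ → ℝ} (hf : IsStep m f) : IsStep (m + 1) f := by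
  induction m generalizing f with
  | zero =>
    obtain ⟨c, rfl⟩ := hf
    exact const 1 c
  | succ m ih =>
    obtain ⟨a, b, ha, hb, rfl⟩ := hf
    exact ⟨a, b, ih ha, ih hb, rfl⟩

theorem mono {m n : ℕ} (h : m ≤ n) {f : ℝ → ℝ} (hf : IsStep m f) : IsStep n f := by
  induction h with
  | refl => exact hf
  | step _ ih => exact ih.succ

theorem periodic {m : ℕ} {f : ℝ → ℝ} (hf : IsStep m f) (x : ℝ) : f (x + 1) = f x := by
  induction m generalizing f x with
  | zero => obtain ⟨c, rfl⟩ := hf; rfl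
  | succ m ih =>
    obtain ⟨a, b, ha, hb, rfl⟩ := hf
    have key : ∀ {c : ℝ → ℝ}, IsStep m c → c (2 * (x + 1)) = c (2 * x) := fun {c} hc => by
      rw [show 2 * (x + 1) = 2 * x + 1 + 1 by ring, ih hc, ih hc]
    simp only [glue, Int.fract_add_one, key ha, key hb]

theorem measurable {m : ℕ} {f : ℝ → ℝ} (hf : IsStep m f) : Measurable f := by
  induction m generalizing f with
  | zero => obtain ⟨c, rfl⟩ := hf; exact measurable_const
  | succ m ih =>
    obtain ⟨a, b, ha, hb, rfl⟩ := hf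
    exact Measurable.ite (measurableSet_lt measurable_fract measurable_const)
      ((ih ha).comp (measurable_const_mul 2)) ((ih hb).comp (measurable_const_mul 2))

theorem bounded {m : ℕ} {f : ℝ → ℝ} (hf : IsStep m f) : ∃ C, ∀ x, |f x| ≤ C := by
  induction m generalizing f with
  | zero => obtain ⟨c, rfl⟩ := hf; exact ⟨|c|, fun _ => le_rfl⟩
  | succ m ih =>
    obtain ⟨a, b, ha, hb, rfl⟩ := hf
    obtain ⟨A, hA⟩ := ih ha
    obtain ⟨B, hB⟩ := ih hb
    refine ⟨max A B, fun x => ?_⟩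
    unfold glue
    split_ifs
    · exact (hA _).trans (le_max_left _ _)
    · exact (hB _).trans (le_max_right _ _)

theorem intervalIntegrable {m : ℕ} {f : ℝ → ℝ} (hf : IsStep m f) (s t : ℝ) :
    IntervalIntegrable f volume s t := by
  obtain ⟨C, hC⟩ := hf.bounded
  exact (intervalIntegrable_const (c := C)).mono_fun hf.measurable.aestronglyMeasurable
    (ae_of_all _ fun x => by simpa using (hC x).trans (le_abs_self C))

theorem memLp {m : ℕ} {f : ℝ → ℝ} (hf : IsStep m f) :
    MemLp f 2 (volume.restrict (Icc (0 : ℝ) 1)) := by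
  obtain ⟨C, hC⟩ := hf.bounded
  exact MemLp.of_bound hf.measurable.aestronglyMeasurable C (ae_of_all _ hC)

end IsStep

/-! ### Integrals and inner products -/

/-- The weight `p` is not periodic, so the two halves see different rescalings of it; this is what
produces moment recursions. -/
theorem integral_mul_glue {m : ℕ} {a b : ℝ → ℝ} (ha : IsStep m a) (hb : IsStep m b) {p : ℝ → ℝ}
    (hp : Continuous p) :
    ∫ u in (0 : ℝ)..1, p u * glue a b u =
      2⁻¹ * ((∫ v in (0 : ℝ)..1, p (v / 2) * a v) + ∫ v in (0 : ℝ)..1, p ((v + 1) / 2) * b v) := by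
  have hg : IsStep (m + 1) (glue a b) := ⟨a, b, ha, hb, rfl⟩
  have hi : ∀ s t : ℝ, IntervalIntegrable (fun u => p u * glue a b u) volume s t := fun s t =>
    (hg.intervalIntegrable s t).continuousOn_mul hp.continuousOn
  rw [← intervalIntegral.integral_add_adjacent_intervals (hi 0 (1 / 2)) (hi (1 / 2) 1), mul_add]
  congr 1
  · have h1 : ∫ u in (0 : ℝ)..(1 / 2), p u * glue a b u =
        ∫ u in (0 : ℝ)..(1 / 2), (fun v => p (v / 2) * a v) (2 * u) := by
      apply intervalIntegral.integral_congr_Ioo_of_le (by norm_num)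
      intro u hu
      have : Int.fract u = u := Int.fract_eq_self.2 ⟨hu.1.le, by linarith [hu.2]⟩
      simp only [glue, this, if_pos hu.2]
      congr 2; ring
    rw [h1, intervalIntegral.integral_comp_mul_left (fun v => p (v / 2) * a v)
      (by norm_num : (2 : ℝ) ≠ 0)]
    norm_num
  · have h1 : ∫ u in (1 / 2 : ℝ)..1, p u * glue a b u =
        ∫ u in (1 / 2 : ℝ)..1, (fun v => p ((v + 1) / 2) * b v) (2 * u - 1) := by
      apply intervalIntegral.integral_congr_Ioo_of_le (by norm_num)
      intro u hu
      have : Int.fract u = u := Int.fract_eq_self.2 ⟨by linarith [hu.1], hu.2⟩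
      have h2 : b (2 * u) = b (2 * u - 1) := by
        conv_lhs => rw [show 2 * u = 2 * u - 1 + 1 by ring, hb.periodic]
      simp only [glue, this, if_neg (not_lt.2 hu.1.le), h2]
      congr 2; ring
    rw [h1, intervalIntegral.integral_comp_mul_sub (fun v => p ((v + 1) / 2) * b v)
      (by norm_num : (2 : ℝ) ≠ 0)]
    norm_num

theorem integral_glue {m : ℕ} {a b : ℝ → ℝ} (ha : IsStep m a) (hb : IsStep m b) :
    ∫ u in (0 : ℝ)..1, glue a b u =
      2⁻¹ * ((∫ v in (0 : ℝ)..1, a v) + ∫ v in (0 : ℝ)..1, b v) := by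
  simpa using integral_mul_glue ha hb (continuous_const (y := (1 : ℝ)))

/-- The inner product of `L²[0,1]`. -/
noncomputable def ip (f g : ℝ → ℝ) : ℝ := ∫ u in (0 : ℝ)..1, f u * g u

theorem ip_comm (f g : ℝ → ℝ) : ip f g = ip g f := by
  simp only [ip, mul_comm]

theorem ip_smul_left (r : ℝ) (f g : ℝ → ℝ) : ip (r • f) g = r * ip f g := by
  simp [ip, mul_assoc]

theorem ip_smul_right (r : ℝ) (f g : ℝ → ℝ) : ip f (r • g) = r * ip f g := by
  rw [ip_comm, ip_smul_left, ip_comm]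

theorem ip_add_left {m : ℕ} {f g h : ℝ → ℝ} (hf : IsStep m f) (hg : IsStep m g)
    (hh : IsStep m h) : ip (f + g) h = ip f h + ip g h := by
  simp only [ip, Pi.add_apply, add_mul]
  exact intervalIntegral.integral_add ((hf.mul hh).intervalIntegrable 0 1)
    ((hg.mul hh).intervalIntegrable 0 1)

theorem ip_add_right {m : ℕ} {f g h : ℝ → ℝ} (hf : IsStep m f) (hg : IsStep m g)
    (hh : IsStep m h) : ip h (f + g) = ip h f + ip h g := by
  rw [ip_comm, ip_add_left hf hg hh, ip_comm f, ip_comm g]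

theorem ip_zero_left (g : ℝ → ℝ) : ip (fun _ => 0) g = 0 := by simp [ip]

theorem ip_zero_right (g : ℝ → ℝ) : ip g (fun _ => 0) = 0 := by simp [ip]

theorem ip_glue {m : ℕ} {a b c d : ℝ → ℝ} (ha : IsStep m a) (hb : IsStep m b) (hc : IsStep m c)
    (hd : IsStep m d) : ip (glue a b) (glue c d) = 2⁻¹ * (ip a c + ip b d) := by
  have := integral_glue (ha.mul hc) (hb.mul hd)
  rwa [← glue_mul] at this

/-! ### Alternation, compression and moments -/

/-- `f` followed by `-f`. -/
noncomputable def alternate (f : ℝ → ℝ) : ℝ → ℝ := glue f ((-1 : ℝ) • f)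

theorem IsStep.alternate {m : ℕ} {f : ℝ → ℝ} (hf : IsStep m f) : IsStep (m + 1) (alternate f) :=
  ⟨_, _, hf, hf.smul _, rfl⟩

theorem ip_alternate {m : ℕ} {f g : ℝ → ℝ} (hf : IsStep m f) (hg : IsStep m g) :
    ip (alternate f) (alternate g) = ip f g := by
  rw [alternate, alternate, ip_glue hf (hf.smul _) hg (hg.smul _), ip_smul_left, ip_smul_right]
  ring

theorem ip_const_alternate {m : ℕ} {f : ℝ → ℝ} (hf : IsStep m f) (c : ℝ) :
    ip (fun _ => c) (alternate f) = 0 := by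
  rw [alternate, ← glue_const c, ip_glue (.const m c) (.const m c) hf (hf.smul _), ip_smul_right]
  ring

/-- Alternation tests `f` against half of p(v/2) - p((v+1)/2), a difference that lowers the degree
of a polynomial p by one. -/
theorem ip_id_alternate {m : ℕ} {f : ℝ → ℝ} (hf : IsStep m f) :
    ip (fun u => u) (alternate f) = -(1 / 4) * ∫ u in (0 : ℝ)..1, f u := by
  have hi := hf.intervalIntegrable 0 1
  rw [ip, alternate, integral_mul_glue hf (hf.smul _) continuous_id',
    ← intervalIntegral.integral_add
      (hi.continuousOn_mul (by fun_prop)) ((hf.smul (-1)).intervalIntegrable 0 1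
        |>.continuousOn_mul (by fun_prop)), ← intervalIntegral.integral_const_mul,
    ← intervalIntegral.integral_const_mul]
  congr 1; funext v
  simp only [Pi.smul_apply, smul_eq_mul]; ring

theorem ip_sq_alternate {m : ℕ} {f : ℝ → ℝ} (hf : IsStep m f) :
    ip (fun u => u ^ 2) (alternate f) =
      -(1 / 4) * ip (fun u => u) f - 1 / 8 * ∫ u in (0 : ℝ)..1, f u := by
  have hi := hf.intervalIntegrable 0 1
  rw [ip, alternate, integral_mul_glue hf (hf.smul _) (continuous_pow 2),
    ← intervalIntegral.integral_add
      (hi.continuousOn_mul (by fun_prop)) ((hf.smul (-1)).intervalIntegrable 0 1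
        |>.continuousOn_mul (by fun_prop)), ip, ← intervalIntegral.integral_const_mul,
    ← intervalIntegral.integral_const_mul, ← intervalIntegral.integral_const_mul,
    ← intervalIntegral.integral_sub ((hi.continuousOn_mul (by fun_prop)).const_mul _)
      (hi.const_mul _)]
  congr 1; funext v
  simp only [Pi.smul_apply, smul_eq_mul]; ring

/-- `f` compressed `m` times by the factor two. -/
noncomputable def compress : ℕ → (ℝ → ℝ) → ℝ → ℝ
  | 0, f => f
  | m + 1, f => glue (compress m f) (compress m f)

theorem IsStep.compress {m : ℕ} {f : ℝ → ℝ} (hf : IsStep m f) (k : ℕ) :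
    IsStep (m + k) (compress k f) := by
  induction k with
  | zero => exact hf
  | succ k ih => exact ⟨_, _, ih, ih, rfl⟩

theorem compress_apply (k : ℕ) (f : ℝ → ℝ) (x : ℝ) : compress k f x = f (2 ^ k * x) := by
  induction k generalizing x with
  | zero => simp [compress]
  | succ k ih => rw [compress, glue, ite_id, ih, pow_succ, mul_assoc]

theorem ip_compress {m : ℕ} {f g : ℝ → ℝ} (hf : IsStep m f) (hg : IsStep m g) (k : ℕ) :
    ip (compress k f) (compress k g) = ip f g := by
  induction k with
  | zero => rfl
  | succ k ih =>
    rw [compress, compress, ip_glue (hf.compress k) (hf.compress k) (hg.compress k)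
      (hg.compress k), ih]
    ring

/-- Each dyadic interval of length 2⁻ᵏ, where `s` is constant, carries one full period of the
compressed function. -/
theorem ip_step_compress {m k : ℕ} {s f : ℝ → ℝ} (hs : IsStep k s) (hf : IsStep m f)
    (h0 : ∫ u in (0 : ℝ)..1, f u = 0) : ip s (compress k f) = 0 := by
  induction k generalizing s with
  | zero =>
    obtain ⟨c, rfl⟩ := hs
    simp [ip, compress, h0]
  | succ k ih =>
    obtain ⟨a, b, ha, hb, rfl⟩ := hs
    rw [compress, ip_glue (m := m + k) (ha.mono (by omega)) (hb.mono (by omega)) (hf.compress k)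
      (hf.compress k), ih ha, ih hb]
    ring

theorem ip_id_glue_self {m : ℕ} {f : ℝ → ℝ} (hf : IsStep m f) :
    ip (fun u => u) (glue f f) = 1 / 2 * ip (fun u => u) f + 1 / 4 * ∫ u in (0 : ℝ)..1, f u := by
  have hi := hf.intervalIntegrable 0 1
  rw [ip, integral_mul_glue hf hf continuous_id',
    ← intervalIntegral.integral_add
      (hi.continuousOn_mul (by fun_prop)) (hi.continuousOn_mul (by fun_prop)), ip,
    ← intervalIntegral.integral_const_mul,
    ← intervalIntegral.integral_const_mul, ← intervalIntegral.integral_const_mul,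
    ← intervalIntegral.integral_add ((hi.continuousOn_mul (by fun_prop)).const_mul _)
      (hi.const_mul _)]
  congr 1; funext v; ring

theorem ip_sq_glue_self {m : ℕ} {f : ℝ → ℝ} (hf : IsStep m f)
    (h0 : ∫ u in (0 : ℝ)..1, f u = 0) (h1 : ip (fun u => u) f = 0) :
    ip (fun u => u ^ 2) (glue f f) = 1 / 4 * ip (fun u => u ^ 2) f := by
  have hi := hf.intervalIntegrable 0 1
  have e : ip (fun u => u ^ 2) (glue f f) = 1 / 4 * ip (fun u => u ^ 2) f +
      (1 / 4 * ip (fun u => u) f + 1 / 8 * ∫ u in (0 : ℝ)..1, f u) := by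
    rw [ip, integral_mul_glue hf hf (continuous_pow 2),
      ← intervalIntegral.integral_add
        (hi.continuousOn_mul (by fun_prop)) (hi.continuousOn_mul (by fun_prop)), ip, ip,
      ← intervalIntegral.integral_const_mul, ← intervalIntegral.integral_const_mul,
      ← intervalIntegral.integral_const_mul, ← intervalIntegral.integral_const_mul,
      ← intervalIntegral.integral_add ((hi.continuousOn_mul (by fun_prop)).const_mul _)
        (hi.const_mul _),
      ← intervalIntegral.integral_add ((hi.continuousOn_mul (by fun_prop)).const_mul _)
        (((hi.continuousOn_mul (by fun_prop)).const_mul _).add (hi.const_mul _))]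
    congr 1; funext v; ring
  rw [e, h0, h1]; ring

/-- Halving the scale of u² gives the factor 1/4; the shift of the second half adds only terms of
lower degree, which the vanishing moments remove. -/
theorem moments_compress {m : ℕ} {f : ℝ → ℝ} (hf : IsStep m f)
    (h0 : ∫ u in (0 : ℝ)..1, f u = 0) (h1 : ip (fun u => u) f = 0) (k : ℕ) :
    (∫ u in (0 : ℝ)..1, compress k f u = 0) ∧ ip (fun u => u) (compress k f) = 0 ∧
      ip (fun u => u ^ 2) (compress k f) = (1 / 4) ^ k * ip (fun u => u ^ 2) f := by
  induction k with
  | zero => simp [compress, h0, h1]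
  | succ k ih =>
    obtain ⟨i0, i1, i2⟩ := ih
    have hk := hf.compress k
    refine ⟨?_, ?_, ?_⟩
    · rw [compress, integral_glue hk hk, i0]; ring
    · rw [compress, ip_id_glue_self hk, i0, i1]; ring
    · rw [compress, ip_sq_glue_self hk i0 i1, i2]; ring

/-! ### Haar functions in midpoint order -/

/-- The unnormalised Haar functions of the first `n` generations, ordered by the midpoints of their
supports. -/
noncomputable def haarTree : ℕ → List (ℝ → ℝ)
  | 0 => []
  | n + 1 => (haarTree n).map (fun d => glue d (fun _ => 0)) ++
      glue (fun _ => -1) (fun _ => 1) :: (haarTree n).map (fun d => glue (fun _ => 0) d)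

theorem isStep_of_mem_haarTree {n : ℕ} {d : ℝ → ℝ} (hd : d ∈ haarTree n) : IsStep n d := by
  induction n generalizing d with
  | zero => simp [haarTree] at hd
  | succ n ih =>
    simp only [haarTree, List.mem_append, List.mem_cons, List.mem_map] at hd
    obtain ⟨e, he, rfl⟩ | rfl | ⟨e, he, rfl⟩ := hd
    · exact ⟨_, _, ih he, .const n 0, rfl⟩
    · exact ⟨_, _, .const n (-1), .const n 1, rfl⟩
    · exact ⟨_, _, .const n 0, ih he, rfl⟩

theorem integral_haarTree {n : ℕ} {d : ℝ → ℝ} (hd : d ∈ haarTree n) :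
    ∫ u in (0 : ℝ)..1, d u = 0 := by
  induction n generalizing d with
  | zero => simp [haarTree] at hd
  | succ n ih =>
    simp only [haarTree, List.mem_append, List.mem_cons, List.mem_map] at hd
    obtain ⟨e, he, rfl⟩ | rfl | ⟨e, he, rfl⟩ := hd
    · rw [integral_glue (isStep_of_mem_haarTree he) (.const n 0), ih he]; simp
    · rw [integral_glue (.const 0 (-1)) (.const 0 1)]; simp
    · rw [integral_glue (.const n 0) (isStep_of_mem_haarTree he), ih he]; simp

theorem ip_haarTree_pos {n : ℕ} {d : ℝ → ℝ} (hd : d ∈ haarTree n) : 0 < ip d d := by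
  induction n generalizing d with
  | zero => simp [haarTree] at hd
  | succ n ih =>
    simp only [haarTree, List.mem_append, List.mem_cons, List.mem_map] at hd
    obtain ⟨e, he, rfl⟩ | rfl | ⟨e, he, rfl⟩ := hd
    · have h := isStep_of_mem_haarTree he
      rw [ip_glue h (.const n 0) h (.const n 0), ip_zero_left]
      linarith [ih he]
    · rw [ip_glue (.const 0 (-1)) (.const 0 1) (.const 0 (-1)) (.const 0 1)]; norm_num [ip]
    · have h := isStep_of_mem_haarTree he
      rw [ip_glue (.const n 0) h (.const n 0) h, ip_zero_left]
      linarith [ih he]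

theorem pairwise_haarTree (n : ℕ) : (haarTree n).Pairwise fun d e => ip d e = 0 := by
  induction n with
  | zero => simp [haarTree]
  | succ n ih =>
    have st := fun d (hd : d ∈ haarTree n) => isStep_of_mem_haarTree hd
    have mean := fun d (hd : d ∈ haarTree n) => integral_haarTree hd
    rw [haarTree, List.pairwise_append, List.pairwise_cons, List.pairwise_map, List.pairwise_map]
    refine ⟨?_, ⟨?_, ?_⟩, ?_⟩
    · refine ih.imp_of_mem fun {d e} hd he h => ?_
      rw [ip_glue (st d hd) (.const n 0) (st e he) (.const n 0), h, ip_zero_left]; ring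
    · intro e' he'
      obtain ⟨e, he, rfl⟩ := List.mem_map.1 he'
      rw [ip_glue (.const n (-1)) (.const n 1) (.const n 0) (st e he), ip_zero_right]
      simp [ip, mean e he]
    · refine ih.imp_of_mem fun {d e} hd he h => ?_
      rw [ip_glue (.const n 0) (st d hd) (.const n 0) (st e he), h, ip_zero_left]; ring
    · intro d' hd' e' he'
      obtain ⟨d, hd, rfl⟩ := List.mem_map.1 hd'
      obtain rfl | he' := List.mem_cons.1 he'
      · rw [ip_glue (st d hd) (.const n 0) (.const n (-1)) (.const n 1), ip_zero_left]
        simp [ip, mean d hd]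
      · obtain ⟨e, he, rfl⟩ := List.mem_map.1 he'
        rw [ip_glue (st d hd) (.const n 0) (.const n 0) (st e he), ip_zero_left, ip_zero_right]
        ring

/-- Each generation has values ±1 on disjoint supports filling the interval, so it contributes 1. -/
theorem sum_ip_haarTree (n : ℕ) : ((haarTree n).map fun d => ip d d).sum = n := by
  induction n with
  | zero => simp [haarTree]
  | succ n ih =>
    have h1 : (haarTree n).map ((fun d => ip d d) ∘ fun d => glue d (fun _ => 0)) =
        (haarTree n).map fun d => 2⁻¹ * ip d d := List.map_congr_left fun d hd => by
      have h := isStep_of_mem_haarTree hd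
      simp [ip_glue h (.const n 0) h (.const n 0), ip_zero_left]
    have h2 : (haarTree n).map ((fun d => ip d d) ∘ fun d => glue (fun _ => 0) d) =
        (haarTree n).map fun d => 2⁻¹ * ip d d := List.map_congr_left fun d hd => by
      have h := isStep_of_mem_haarTree hd
      simp [ip_glue (.const n 0) h (.const n 0) h, ip_zero_left]
    have h3 : ip (glue (fun _ => -1) (fun _ => 1)) (glue (fun _ => -1) (fun _ => 1)) = 1 := by
      rw [ip_glue (.const 0 (-1)) (.const 0 1) (.const 0 (-1)) (.const 0 1)]; norm_num [ip]
    rw [haarTree, List.map_append, List.map_cons, List.sum_append, List.sum_cons, List.map_map,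
      List.map_map, h1, h2, List.sum_map_mul_left, ih, h3]
    push_cast; ring

/-- At every point `x` the sum over all the Haar functions is the difference between the numbers
`R` and `n - R` of positive and of negative terms; some initial segment contains just the positive
terms. -/
theorem exists_prefix_haarTree (n : ℕ) (x : ℝ) :
    ∃ R : ℝ, 0 ≤ R ∧ R ≤ n ∧ ((haarTree n).map fun d => d x).sum = 2 * R - n ∧
      ∃ A, A <+: haarTree n ∧ (A.map fun d => d x).sum = R := by
  induction n generalizing x with
  | zero => exact ⟨0, le_rfl, by simp, by simp [haarTree], [], by simp⟩
  | succ n ih =>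
    obtain ⟨R, h0, hn, hs, A, hA, hR⟩ := ih (2 * x)
    -- In the left half the root is -1 and the prefix stops inside the left subtree; in the right
    -- half it passes the whole left subtree, zero at x, and the root, which is +1.
    by_cases hx : Int.fract x < 1 / 2
    · refine ⟨R, h0, by push_cast; linarith, ?_, A.map fun d => glue d (fun _ => 0), ?_, ?_⟩
      · simp only [haarTree, List.map_append, List.map_cons, List.sum_append, List.sum_cons,
          List.map_map, Function.comp_def, glue, if_pos hx, hs]
        simp only [List.map_const', List.sum_replicate, smul_zero]
        push_cast; ring
      · exact (hA.map _).trans (List.prefix_append _ _)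
      · simpa only [List.map_map, Function.comp_def, glue, if_pos hx] using hR
    · refine ⟨R + 1, by linarith, by push_cast; linarith, ?_,
        (haarTree n).map (fun d => glue d (fun _ => 0)) ++
          glue (fun _ => -1) (fun _ => 1) :: A.map fun d => glue (fun _ => 0) d, ?_, ?_⟩
      · simp only [haarTree, List.map_append, List.map_cons, List.sum_append, List.sum_cons,
          List.map_map, Function.comp_def, glue, if_neg hx, hs]
        simp only [List.map_const', List.sum_replicate, smul_zero]
        push_cast; ring
      · rw [haarTree, List.prefix_append_right_inj, List.cons_prefix_cons]
        exact ⟨rfl, hA.map _⟩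
      · simp only [List.map_append, List.map_cons, List.sum_append, List.sum_cons,
          List.map_map, Function.comp_def, glue, if_neg hx, hR]
        simp only [List.map_const', List.sum_replicate, smul_zero]
        ring

/-! ### Sums of orthogonal lists -/

theorem IsStep.list_sum {m : ℕ} {L : List (ℝ → ℝ)} (hL : ∀ d ∈ L, IsStep m d) :
    IsStep m L.sum := by
  induction L with
  | nil => exact .const m 0
  | cons a l ih =>
    rw [List.forall_mem_cons] at hL
    exact hL.1.add (ih hL.2)

theorem ip_list_sum {m : ℕ} {L : List (ℝ → ℝ)} (hL : ∀ d ∈ L, IsStep m d) {g : ℝ → ℝ}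
    (hg : IsStep m g) : ip g L.sum = (L.map fun d => ip g d).sum := by
  induction L with
  | nil => exact ip_zero_right g
  | cons a l ih =>
    rw [List.forall_mem_cons] at hL
    rw [List.sum_cons, ip_add_right hL.1 (.list_sum hL.2) hg, ih hL.2, List.map_cons,
      List.sum_cons]

theorem ip_list_sum_of_mem {m : ℕ} {L : List (ℝ → ℝ)} (hL : ∀ d ∈ L, IsStep m d)
    (ho : L.Pairwise fun d e => ip d e = 0) {d : ℝ → ℝ} (hd : d ∈ L) :
    ip d L.sum = ip d d := by
  induction L with
  | nil => simp at hd
  | cons a l ih =>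
    rw [List.forall_mem_cons] at hL
    rw [List.pairwise_cons] at ho
    obtain rfl | hd := List.mem_cons.1 hd
    · rw [List.sum_cons, ip_add_right hL.1 (.list_sum hL.2) hL.1, ip_list_sum hL.2 hL.1,
        List.map_congr_left ho.1]
      simp
    · rw [List.sum_cons, ip_add_right hL.1 (.list_sum hL.2) (hL.2 d hd), ih hL.2 ho.2 hd,
        ip_comm, ho.1 d hd, zero_add]

theorem list_sum_apply (L : List (ℝ → ℝ)) (x : ℝ) : L.sum x = (L.map fun d => d x).sum := by
  induction L with
  | nil => rfl
  | cons a l ih => simp [ih]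

/-- The sign depends on x alone, so it factors out of whole partial sums. -/
theorem alternate_apply (x : ℝ) :
    ∃ ε : ℝ, |ε| = 1 ∧ ∀ f, alternate f x = ε * f (2 * x) := by
  by_cases hx : Int.fract x < 1 / 2
  · exact ⟨1, by simp, fun f => by simp only [alternate, glue, if_pos hx, one_mul]⟩
  · exact ⟨-1, by simp, fun f => by
      simp only [alternate, glue, if_neg hx, Pi.smul_apply, smul_eq_mul]⟩

/-! ### Rotation and large partial sums of the constant 1 -/

/-- The rotation of an orthogonal system `d` with sum `f` in the plane of `f` and the constants
gives its members nonzero means. -/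
theorem ip_rotate {m : ℕ} {d e f : ℝ → ℝ} (hd : IsStep m d) (he : IsStep m e) (hf : IsStep m f)
    (hdf : ip d f = ip d d) (hef : ip e f = ip e e) (hd1 : ip (fun _ => 1) d = 0)
    (he1 : ip (fun _ => 1) e = 0) (hf1 : ip (fun _ => 1) f = 0) {a b : ℝ}
    (hab : 2 * a + a ^ 2 * ip f f + b ^ 2 = 0) :
    ip (d + ip d d • (a • f + b • fun _ => 1)) (e + ip e e • (a • f + b • fun _ => 1)) =
      ip d e := by
  have h1 : IsStep m (fun _ => 1) := .const m 1
  have hz : IsStep m (a • f + b • fun _ => 1) := (hf.smul a).add (h1.smul b)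
  have h11 : ip (fun _ => 1) (fun _ => 1) = 1 := by simp [ip]
  rw [ip_add_left hd (hz.smul _) (he.add (hz.smul _)), ip_add_right he (hz.smul _) hd,
    ip_add_right he (hz.smul _) (hz.smul _)]
  simp only [ip_smul_left, ip_smul_right]
  rw [ip_add_left (hf.smul a) (h1.smul b) he, ip_add_right (hf.smul a) (h1.smul b) hd,
    ip_add_left (hf.smul a) (h1.smul b) hz, ip_add_right (hf.smul a) (h1.smul b) (hf.smul a),
    ip_add_right (hf.smul a) (h1.smul b) (h1.smul b)]
  simp only [ip_smul_left, ip_smul_right]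
  rw [ip_comm d (fun _ => 1), ip_comm f (fun _ => 1), ip_comm f e, hd1, he1, hf1, h11, hdf, hef]
  linear_combination (ip d d * ip e e) * hab

/-- The prefix sum wins when R ≥ q²/4, the full sum otherwise. Here σ is the share of the total
squared norm in the prefix, and the constant component contributes at most 16/25, absorbed by the
-1. -/
theorem abs_rotated_sum_ge {q R σ ε : ℝ} (hq : 1 ≤ q) (hR0 : 0 ≤ R) (hR : R ≤ q ^ 2)
    (hσ0 : 0 ≤ σ) (hσ1 : σ ≤ 1) (hε : |ε| = 1) :
    q / 5 - 1 ≤ |4 / (5 * q) * (ε * R + σ * q ^ 2 * (-(2 / (5 * q ^ 2)) * (ε * (2 * R - q ^ 2)) +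
        4 / (5 * q)))| ∨
      q / 5 - 1 ≤ |4 / (5 * q) * (ε * (2 * R - q ^ 2) + q ^ 2 *
        (-(2 / (5 * q ^ 2)) * (ε * (2 * R - q ^ 2)) + 4 / (5 * q)))| := by
  have hq0 : 0 < q := by linarith
  have e1 : 4 / (5 * q) * (ε * R + σ * q ^ 2 * (-(2 / (5 * q ^ 2)) * (ε * (2 * R - q ^ 2)) +
      4 / (5 * q))) = ε * (4 / (5 * q) * (R - 2 / 5 * σ * (2 * R - q ^ 2))) + 16 / 25 * σ := by
    field_simp; ring
  have e2 : 4 / (5 * q) * (ε * (2 * R - q ^ 2) + q ^ 2 *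
      (-(2 / (5 * q ^ 2)) * (ε * (2 * R - q ^ 2)) + 4 / (5 * q))) =
      ε * (4 / (5 * q) * (3 / 5 * (2 * R - q ^ 2))) + 16 / 25 := by
    field_simp; ring
  have key : ∀ y c : ℝ, 0 ≤ c → c ≤ 1 → q / 5 ≤ |y| → q / 5 - 1 ≤ |ε * y + c| := by
    intro y c hc0 hc1 hy
    have h1 : |ε * y| = |y| := by rw [abs_mul, hε, one_mul]
    have h2 := abs_add_le (ε * y + c) (-c)
    rw [add_neg_cancel_right, h1, abs_neg, abs_of_nonneg hc0] at h2
    linarith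
  rw [e1, e2]
  by_cases h : q ^ 2 / 4 ≤ R
  · left
    refine key _ _ (by positivity) (by linarith) (le_trans ?_ (le_abs_self _))
    have : q ^ 2 / 4 ≤ R - 2 / 5 * σ * (2 * R - q ^ 2) := by
      nlinarith [mul_nonneg hσ0 (sub_nonneg.2 hR), mul_nonneg hσ0 hR0,
        mul_nonneg (sub_nonneg.2 hσ1) (sub_nonneg.2 h), mul_nonneg hσ0 (sub_nonneg.2 h)]
    calc q / 5 = 4 / (5 * q) * (q ^ 2 / 4) := by field_simp
      _ ≤ _ := by gcongr
  · right
    refine key _ _ (by norm_num) (by norm_num) (le_trans ?_ (neg_le_abs _))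
    have : q ^ 2 / 4 ≤ 3 / 5 * (q ^ 2 - 2 * R) := by nlinarith
    calc q / 5 = 4 / (5 * q) * (q ^ 2 / 4) := by field_simp
      _ ≤ 4 / (5 * q) * (3 / 5 * (q ^ 2 - 2 * R)) := by gcongr
      _ = _ := by ring

/-- A finite orthogonal system of step functions for which the partial sums of the constant
function `1` are large at every point. -/
theorem exists_orthogonal_partialSums_one_large (K : ℝ) :
    ∃ (m : ℕ) (L : List (ℝ → ℝ)), (∀ ψ ∈ L, IsStep m ψ ∧ 0 < ip ψ ψ) ∧
      (L.Pairwise fun ψ χ => ip ψ χ = 0) ∧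
      ∀ x, ∃ A, A <+: L ∧ K ≤ |(A.map fun ψ => ip (fun _ => 1) ψ / ip ψ ψ * ψ x).sum| := by
  obtain ⟨q, hq1, hqK⟩ : ∃ q : ℕ, 1 ≤ q ∧ K ≤ q / 5 - 1 := by
    obtain ⟨q, hq⟩ := exists_nat_ge (5 * (K + 1))
    exact ⟨q + 1, by omega, by push_cast; linarith⟩
  have hq1' : (1 : ℝ) ≤ q := by exact_mod_cast hq1
  have hq0 : (q : ℝ) ≠ 0 := by positivity
  set T := (haarTree (q ^ 2)).map alternate with hT
  set f := T.sum with hf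
  have hst : ∀ d ∈ T, IsStep (q ^ 2 + 1) d := List.forall_mem_map.2 fun d hd =>
    (isStep_of_mem_haarTree hd).alternate
  have hfst : IsStep (q ^ 2 + 1) f := .list_sum hst
  have hort : T.Pairwise fun d e => ip d e = 0 := List.pairwise_map.2 <|
    (pairwise_haarTree _).imp_of_mem fun {d e} hd he h => by
      rwa [ip_alternate (isStep_of_mem_haarTree hd) (isStep_of_mem_haarTree he)]
  have hpos : ∀ d ∈ T, 0 < ip d d := List.forall_mem_map.2 fun d hd => by
    rw [ip_alternate (isStep_of_mem_haarTree hd) (isStep_of_mem_haarTree hd)]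
    exact ip_haarTree_pos hd
  have hsum : (T.map fun d => ip d d).sum = (q : ℝ) ^ 2 := by
    rw [hT, List.map_map, ← Nat.cast_pow, ← sum_ip_haarTree (q ^ 2)]
    congr 1
    exact List.map_congr_left fun d hd =>
      ip_alternate (isStep_of_mem_haarTree hd) (isStep_of_mem_haarTree hd)
  have hone : ∀ d ∈ T, ip (fun _ => 1) d = 0 := List.forall_mem_map.2 fun d hd =>
    ip_const_alternate (isStep_of_mem_haarTree hd) 1
  have hdf : ∀ d ∈ T, ip d f = ip d d := fun d hd => ip_list_sum_of_mem hst hort hd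
  have hf1 : ip (fun _ => 1) f = 0 := by
    rw [hf, ip_list_sum hst (.const _ 1), List.map_congr_left hone]; simp
  have hff : ip f f = (q : ℝ) ^ 2 := by
    rw [← hsum, ← List.map_congr_left hdf, hf, ip_list_sum hst hfst]
    exact congrArg List.sum (List.map_congr_left fun d _ => ip_comm _ _)
  -- The 3-4-5 rotation: d ↦ d + ⟨d, f⟩(a f + b) sends f/q to (3/5) f/q + 4/5.
  set a : ℝ := -(2 / (5 * (q : ℝ) ^ 2)) with ha
  set b : ℝ := 4 / (5 * (q : ℝ)) with hb
  have hab : 2 * a + a ^ 2 * ip f f + b ^ 2 = 0 := by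
    rw [hff, ha, hb]; field_simp; ring
  set z : ℝ → ℝ := a • f + b • fun _ => 1 with hz
  have hzst : IsStep (q ^ 2 + 1) z := (hfst.smul a).add ((IsStep.const _ 1).smul b)
  set Ψ : (ℝ → ℝ) → ℝ → ℝ := fun d => d + ip d d • z with hΨ
  have hip : ∀ d ∈ T, ∀ e ∈ T, ip (Ψ d) (Ψ e) = ip d e := fun d hd e he =>
    ip_rotate (hst d hd) (hst e he) hfst (hdf d hd) (hdf e he) (hone d hd) (hone e he) hf1 hab
  have hmean : ∀ d ∈ T, ip (fun _ => 1) (Ψ d) = ip d d * b := fun d hd => by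
    have h11 : ip (fun _ => 1) (fun _ => 1) = 1 := by simp [ip]
    rw [hΨ, hz, ip_add_right (hst d hd) (hzst.smul _) (.const _ 1), ip_smul_right,
      ip_add_right (hfst.smul _) ((IsStep.const _ 1).smul _) (.const _ 1), ip_smul_right,
      ip_smul_right, hone d hd, hf1, h11]
    ring
  refine ⟨q ^ 2 + 1, T.map Ψ, List.forall_mem_map.2 fun d hd => ⟨(hst d hd).add (hzst.smul _), ?_⟩,
    List.pairwise_map.2 (hort.imp_of_mem fun {d e} hd he h => ?_), fun x => ?_⟩
  · rw [hip d hd d hd]; exact hpos d hd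
  · rw [hip d hd e he, h]
  obtain ⟨ε, hε, halt⟩ := alternate_apply x
  obtain ⟨R, hR0, hRn, hRs, A, hA, hAR⟩ := exists_prefix_haarTree (q ^ 2) (2 * x)
  push_cast at hRn hRs
  have halts : ∀ B : List (ℝ → ℝ), ((B.map alternate).map fun d => d x).sum =
      ε * (B.map fun d => d (2 * x)).sum := fun B => by
    simp only [List.map_map, Function.comp_def, halt, List.sum_map_mul_left]
  have hfx : f x = ε * (2 * R - (q : ℝ) ^ 2) := by
    rw [hf, list_sum_apply, hT, halts, hRs]
  have hzx : z x = a * (ε * (2 * R - (q : ℝ) ^ 2)) + b := by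
    simp [hz, hfx]
  -- Mean over squared norm equals b for every rotated function, so Fourier sums of 1 are b times
  -- plain sums.
  have hterm : ∀ B, B <+: T → ((B.map Ψ).map fun ψ => ip (fun _ => 1) ψ / ip ψ ψ * ψ x).sum =
      b * ((B.map fun d => d x).sum + (B.map fun d => ip d d).sum * z x) := fun B hB => by
    rw [← List.sum_map_mul_right, ← List.sum_map_add, ← List.sum_map_mul_left, List.map_map]
    congr 1
    refine List.map_congr_left fun d hd => ?_
    have hd' := hB.subset hd
    have := (hpos d hd').ne'
    simp only [Function.comp_apply, hmean d hd', hip d hd' d hd']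
    simp only [hΨ, Pi.add_apply, Pi.smul_apply, smul_eq_mul]
    field_simp
  have hAT : A.map alternate <+: T := hA.map _
  have hs0 : 0 ≤ ((A.map alternate).map fun d => ip d d).sum :=
    List.sum_nonneg (List.forall_mem_map.2 fun d hd => (hpos d (hAT.subset hd)).le)
  have hs1 : ((A.map alternate).map fun d => ip d d).sum ≤ (q : ℝ) ^ 2 := by
    rw [← hsum]
    refine (hAT.map fun d => ip d d).sublist.sum_le_sum ?_
    exact List.forall_mem_map.2 fun d hd => (hpos d hd).le
  obtain h | h := abs_rotated_sum_ge (σ := ((A.map alternate).map fun d => ip d d).sum / q ^ 2)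
    hq1' hR0 hRn (by positivity) (div_le_one_of_le₀ hs1 (by positivity)) hε
  · refine ⟨_, hAT.map Ψ, hqK.trans (h.trans_eq ?_)⟩
    rw [hterm _ hAT, halts, hAR, hzx, div_mul_cancel₀ _ (by positivity)]
  · refine ⟨_, List.prefix_refl _, hqK.trans (h.trans_eq ?_)⟩
    rw [hterm _ (List.prefix_refl _), hsum, hT, halts, hRs, hzx]

/-! ### From the constant 1 to the square -/

/-- The Fourier term of `u ↦ u ^ 2` with respect to the orthogonal function `ψ`. -/
noncomputable def sqTerm (x : ℝ) (ψ : ℝ → ℝ) : ℝ := ip (fun u => u ^ 2) ψ / ip ψ ψ * ψ x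

/-- A finite orthogonal system of step functions, orthogonal to the affine functions and to all step
functions of order `k`, for which the partial sums of `u ↦ u ^ 2` are large at every point. -/
theorem exists_orthogonal_partialSums_sq_large (K : ℝ) (k : ℕ) :
    ∃ (m : ℕ) (L : List (ℝ → ℝ)), k ≤ m ∧
      (∀ ψ ∈ L, IsStep m ψ ∧ 0 < ip ψ ψ ∧ (∫ u in (0 : ℝ)..1, ψ u = 0) ∧
        ip (fun u => u) ψ = 0 ∧ ∀ s, IsStep k s → ip s ψ = 0) ∧
      (L.Pairwise fun ψ χ => ip ψ χ = 0) ∧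
      ∀ x, ∃ A, A <+: L ∧ K ≤ |(A.map (sqTerm x)).sum| := by
  -- Two alternations cost a factor 16 and k compressions a factor 4ᵏ; the target is raised to
  -- compensate.
  obtain ⟨m, L, hL, ho, hlarge⟩ := exists_orthogonal_partialSums_one_large (16 * 4 ^ k * K)
  set Φ : (ℝ → ℝ) → ℝ → ℝ := fun ψ => compress k (alternate (alternate ψ)) with hΦ
  have hm0 : ∀ {n f}, IsStep n f → ∫ u in (0 : ℝ)..1, alternate f u = 0 := fun hf => by
    simpa [ip] using ip_const_alternate hf 1
  have hmom : ∀ ψ ∈ L, (∫ u in (0 : ℝ)..1, Φ ψ u = 0) ∧ ip (fun u => u) (Φ ψ) = 0 ∧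
      ip (fun u => u ^ 2) (Φ ψ) = (1 / 4) ^ k * (1 / 16 * ip (fun _ => 1) ψ) := fun ψ hψ => by
    have h := (hL ψ hψ).1
    have h1 : ip (fun u => u) (alternate (alternate ψ)) = 0 := by
      rw [ip_id_alternate h.alternate, hm0 h, mul_zero]
    obtain ⟨i0, i1, i2⟩ := moments_compress h.alternate.alternate (hm0 h.alternate) h1 k
    refine ⟨i0, i1, i2.trans ?_⟩
    rw [ip_sq_alternate h.alternate, ip_id_alternate h, hm0 h]
    simp only [ip, one_mul]; ring
  have hip : ∀ ψ ∈ L, ∀ χ ∈ L, ip (Φ ψ) (Φ χ) = ip ψ χ := fun ψ hψ χ hχ => by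
    have h := (hL ψ hψ).1
    have h' := (hL χ hχ).1
    rw [hΦ, ip_compress h.alternate.alternate h'.alternate.alternate,
      ip_alternate h.alternate h'.alternate, ip_alternate h h']
  refine ⟨m + 1 + 1 + k, L.map Φ, by omega, List.forall_mem_map.2 fun ψ hψ =>
    ⟨(hL ψ hψ).1.alternate.alternate.compress k, ?_, (hmom ψ hψ).1, (hmom ψ hψ).2.1,
      fun s hs => ip_step_compress hs (hL ψ hψ).1.alternate.alternate
        (hm0 (hL ψ hψ).1.alternate)⟩,
    List.pairwise_map.2 (ho.imp_of_mem fun {ψ χ} hψ hχ h => ?_), fun x => ?_⟩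
  · rw [hip ψ hψ ψ hψ]; exact (hL ψ hψ).2
  · rw [hip ψ hψ χ hχ, h]
  obtain ⟨ε, hε, h1⟩ := alternate_apply (2 ^ k * x)
  obtain ⟨δ, hδ, h2⟩ := alternate_apply (2 * (2 ^ k * x))
  obtain ⟨A, hA, hK⟩ := hlarge (2 * (2 * (2 ^ k * x)))
  refine ⟨A.map Φ, hA.map Φ, ?_⟩
  have e : ((A.map Φ).map (sqTerm x)).sum = (1 / 4) ^ k * (1 / 16) * (ε * δ) *
      (A.map fun ψ => ip (fun _ => 1) ψ / ip ψ ψ * ψ (2 * (2 * (2 ^ k * x)))).sum := by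
    rw [← List.sum_map_mul_left, List.map_map]
    congr 1
    refine List.map_congr_left fun ψ hψ => ?_
    have hψ' := hA.subset hψ
    rw [Function.comp_apply, sqTerm, (hmom ψ hψ').2.2, hip ψ hψ' ψ hψ', hΦ]
    simp only [compress_apply, h1, h2]
    ring
  rw [e, abs_mul, abs_mul, abs_mul ε, hε, hδ, abs_of_pos (by positivity)]
  calc K = (1 / 4) ^ k * (1 / 16) * (1 * 1) * (16 * 4 ^ k * K) := by
        rw [div_pow, one_pow]; field_simp
    _ ≤ _ := by gcongr

/-! ### Concatenation of the blocks -/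

/-- An infinite sequence of orthogonal step functions, orthogonal to the affine functions, for which
the partial sums of `u ↦ u ^ 2` are unbounded at every point. -/
theorem exists_orthogonal_partialSums_sq_unbounded :
    ∃ Ψ : ℕ → ℝ → ℝ, (∀ n, (∃ m, IsStep m (Ψ n)) ∧ 0 < ip (Ψ n) (Ψ n) ∧
        (∫ u in (0 : ℝ)..1, Ψ n u = 0) ∧ ip (fun u => u) (Ψ n) = 0) ∧
      (∀ m n, m ≠ n → ip (Ψ m) (Ψ n) = 0) ∧
      ∀ (x c : ℝ) (N : ℕ), ∃ n, N ≤ n ∧ c ≤ |∑ k ∈ Finset.range n, sqTerm x (Ψ k)| := by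
  choose m L hm hL ho hlarge using exists_orthogonal_partialSums_sq_large
  -- The second component is a step order valid for all functions so far; the next block is made
  -- orthogonal to that order.
  let s : ℕ → List (ℝ → ℝ) × ℕ := Nat.rec ([], 0) fun j p =>
    (p.1 ++ L (2 * (j + 1)) p.2, m (2 * (j + 1)) p.2)
  set l : ℕ → List (ℝ → ℝ) := fun j => (s j).1 with hl
  set B : ℕ → List (ℝ → ℝ) := fun j => L (2 * (j + 1)) (s j).2 with hB
  have hsucc : ∀ j, l (j + 1) = l j ++ B j := fun _ => rfl
  have hmem : ∀ j, ∀ ψ ∈ l j, IsStep (s j).2 ψ ∧ 0 < ip ψ ψ ∧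
      (∫ u in (0 : ℝ)..1, ψ u = 0) ∧ ip (fun u => u) ψ = 0 := by
    intro j
    induction j with
    | zero => intro ψ hψ; simp [hl, s] at hψ
    | succ j ih =>
      intro ψ hψ
      rw [hsucc, List.mem_append] at hψ
      obtain h | h := hψ
      · exact ⟨(ih ψ h).1.mono (hm _ _), (ih ψ h).2⟩
      · obtain ⟨h1, h2, h3, h4, -⟩ := hL _ _ ψ h
        exact ⟨h1, h2, h3, h4⟩
  have hpair : ∀ j, (l j).Pairwise fun ψ χ => ip ψ χ = 0 := by
    intro j
    induction j with
    | zero => simp [hl, s]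
    | succ j ih =>
      rw [hsucc, List.pairwise_append]
      exact ⟨ih, ho _ _, fun ψ hψ χ hχ => (hL _ _ χ hχ).2.2.2.2 ψ (hmem j ψ hψ).1⟩
  have hlen : ∀ j, j ≤ (l j).length := by
    intro j
    induction j with
    | zero => exact Nat.zero_le _
    | succ j ih =>
      -- An empty block could not reach its positive target.
      have : B j ≠ [] := by
        intro h
        obtain ⟨A, hA, hK⟩ := hlarge (2 * (j + 1)) (s j).2 0
        rw [show L (2 * (j + 1)) (s j).2 = [] from h, List.prefix_nil] at hA
        rw [hA] at hK
        simp only [List.map_nil, List.sum_nil, abs_zero] at hK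
        have : (0 : ℝ) ≤ j := by positivity
        linarith
      have := List.length_pos_of_ne_nil this
      rw [hsucc, List.length_append]
      omega
  have hmono : ∀ {i j}, i ≤ j → l i <+: l j := fun {i j} hij => by
    induction hij with
    | refl => exact List.prefix_refl _
    | step _ ih => exact ih.trans (by rw [hsucc]; exact List.prefix_append _ _)
  -- Stage n + 1 is long enough to have an entry n, and later stages only extend it.
  set Ψ : ℕ → ℝ → ℝ := fun n => (l (n + 1))[n]'(hlen (n + 1)) with hΨ
  have hget : ∀ j i, (hi : i < (l j).length) → (l j)[i] = Ψ i := fun j i hi => by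
    obtain h | h := le_total j (i + 1)
    · exact (hmono h).getElem hi
    · exact ((hmono h).getElem (hlen (i + 1))).symm
  have hprefix : ∀ {P j}, P <+: l j → ∀ x,
      ∑ k ∈ Finset.range P.length, sqTerm x (Ψ k) = (P.map (sqTerm x)).sum := by
    intro P j hP x
    rw [Finset.sum_range, ← Fin.sum_univ_fun_getElem]
    refine Finset.sum_congr rfl fun i _ => ?_
    rw [hP.getElem i.2, hget j i (i.2.trans_le hP.length_le)]
  refine ⟨Ψ, fun n => ?_, ?_, fun x c N => ?_⟩
  · obtain ⟨h1, h2⟩ := hmem (n + 1) (Ψ n) (List.getElem_mem _)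
    exact ⟨⟨_, h1⟩, h2⟩
  · have key : ∀ i n, i < n → ip (Ψ i) (Ψ n) = 0 := fun i n h => by
      have hi : i < (l (n + 1)).length := by have := hlen (n + 1); omega
      have h0 : ip (l (n + 1))[i] (Ψ n) = 0 :=
        List.pairwise_iff_getElem.1 (hpair (n + 1)) i n hi (hlen (n + 1)) h
      exact (congrArg (ip · (Ψ n)) (hget (n + 1) i hi)).symm.trans h0
    intro i n hin
    obtain h | h := lt_or_gt_of_ne hin
    · exact key i n h
    · rw [ip_comm, key n i h]
  · obtain ⟨j, hj⟩ := exists_nat_ge (max c N)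
    have hjc : c ≤ j := (le_max_left _ _).trans hj
    have hjN : N ≤ j := by exact_mod_cast (le_max_right _ _).trans hj
    obtain ⟨A, hA, hK⟩ := hlarge (2 * (j + 1)) (s j).2 x
    have h1 := hprefix (List.prefix_refl (l j)) x
    have h2 := hprefix (P := l j ++ A) (j := j + 1)
      (by rw [hsucc]; exact (List.prefix_append_right_inj _).2 hA) x
    rw [List.map_append, List.sum_append, ← h1] at h2
    have h3 := eq_sub_of_add_eq' h2.symm
    rw [h3] at hK
    have h4 := hK.trans (abs_sub _ _)
    -- Two partial sums differ by at least 2(j + 1) ≥ 2c, so one of them has absolute value at least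
    -- c.
    by_cases h : c ≤ |∑ k ∈ Finset.range (l j).length, sqTerm x (Ψ k)|
    · exact ⟨_, hjN.trans (hlen j), h⟩
    · refine ⟨(l j ++ A).length, ?_, ?_⟩
      · rw [List.length_append]; have := hlen j; omega
      · push Not at h; linarith

/-! ### Normalisation and conclusion -/

theorem isCL_sq : IsCL fun u => u ^ 2 := by
  refine ⟨by fun_prop, 2, ?_⟩
  have h : EqOn (derivWithin (fun u : ℝ => u ^ 2) (Icc 0 1)) (fun u => 2 * u) (Icc 0 1) :=
    fun x hx => by
      rw [((hasDerivAt_pow 2 x).hasDerivWithinAt).derivWithin (uniqueDiffOn_Icc zero_lt_one x hx)]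
      simp
  refine LipschitzOnWith.of_dist_le_mul fun x hx y hy => ?_
  rw [h hx, h hy, Real.dist_eq, Real.dist_eq, ← mul_sub, abs_mul]
  simp

theorem memE_of_fourierCoefficient_eq_zero {φ : ℕ → ℝ → ℝ} {f : ℝ → ℝ}
    (h : ∀ n, fourierCoefficient φ f n = 0) (x : ℝ) : MemE φ x f := by
  have : (fun n => fourierPartialSum φ f n x) = fun _ => 0 := by
    funext n; simp [fourierPartialSum, h]
  rw [MemE, this]
  exact Asymptotics.isBigO_zero _ _

theorem limsup_ereal_eq_top {a : ℕ → ℝ} (h : ∀ (c : ℝ) (N : ℕ), ∃ n, N ≤ n ∧ c ≤ a n) :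
    limsup (fun n => (a n : EReal)) atTop = ⊤ := by
  refine EReal.eq_top_iff_forall_lt _ |>.2 fun c => ?_
  have : ∃ᶠ n in atTop, ((c + 1 : ℝ) : EReal) ≤ (a n : EReal) :=
    frequently_atTop.2 fun N => by
      obtain ⟨n, hn, hc⟩ := h (c + 1) N
      exact ⟨n, hn, EReal.coe_le_coe_iff.2 hc⟩
  exact (EReal.coe_lt_coe_iff.2 (lt_add_one c)).trans_le (le_limsup_of_frequently_le this)

theorem theorem3p3 :
    ∃ (g : ℝ → ℝ) (G : ℕ → ℝ → ℝ),
      IsCL g ∧ IsONS G ∧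
      (∀ n, ∫ u in (0 : ℝ)..1, G n u = 0) ∧
      (∀ n, ∫ u in (0 : ℝ)..1, u * G n u = 0) ∧
      (∀ x ∈ Icc (0 : ℝ) 1, MemE G x (fun _ => 1) ∧ MemE G x (fun u => u)) ∧
      (∀ᵐ x ∂(volume.restrict (Icc (0 : ℝ) 1)),
        limsup (fun n : ℕ => ((|fourierPartialSum G g n x| : ℝ) : EReal)) atTop = ⊤) := by
  obtain ⟨Ψ, hΨ, ho, hlarge⟩ := exists_orthogonal_partialSums_sq_unbounded
  set G : ℕ → ℝ → ℝ := fun n => (√(ip (Ψ n) (Ψ n)))⁻¹ • Ψ n with hG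
  have h0 : ∀ n, ∫ u in (0 : ℝ)..1, G n u = 0 := fun n => by
    simp only [hG, Pi.smul_apply, smul_eq_mul]
    rw [intervalIntegral.integral_const_mul, (hΨ n).2.2.1, mul_zero]
  have h1 : ∀ n, ∫ u in (0 : ℝ)..1, u * G n u = 0 := fun n => by
    have := ip_smul_right (√(ip (Ψ n) (Ψ n)))⁻¹ (fun u => u) (Ψ n)
    rwa [(hΨ n).2.2.2, mul_zero] at this
  have hsq : ∀ n, (√(ip (Ψ n) (Ψ n)))⁻¹ * (√(ip (Ψ n) (Ψ n)))⁻¹ = (ip (Ψ n) (Ψ n))⁻¹ :=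
    fun n => by rw [← mul_inv, Real.mul_self_sqrt (hΨ n).2.1.le]
  refine ⟨fun u => u ^ 2, G, isCL_sq, ⟨fun n => ?_, fun i n => ?_⟩, h0, h1, fun x _ => ⟨?_, ?_⟩,
    ae_of_all _ fun x => limsup_ereal_eq_top fun c N => ?_⟩
  · obtain ⟨m, hm⟩ := (hΨ n).1
    exact (hm.smul _).memLp
  · change ip (G i) (G n) = _
    rw [hG, ip_smul_left, ip_smul_right]
    split_ifs with h
    · subst h
      rw [← mul_assoc, hsq, inv_mul_cancel₀ (hΨ i).2.1.ne']
    · rw [ho i n h, mul_zero, mul_zero]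
  · exact memE_of_fourierCoefficient_eq_zero (fun n => by simp [fourierCoefficient, h0]) x
  · exact memE_of_fourierCoefficient_eq_zero h1 x
  · obtain ⟨n, hn, hc⟩ := hlarge x c N
    refine ⟨n, hn, hc.trans_eq ?_⟩
    rw [fourierPartialSum]
    congr 1
    -- The normalising root occurs in both the coefficient and the function, giving the division by
    -- the squared norm in `sqTerm`.
    refine Finset.sum_congr rfl fun k _ => ?_
    have : fourierCoefficient G (fun u => u ^ 2) k =
        (√(ip (Ψ k) (Ψ k)))⁻¹ * ip (fun u => u ^ 2) (Ψ k) := ip_smul_right _ _ _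
    rw [this, sqTerm, div_eq_mul_inv, ← hsq]
    simp only [hG, Pi.smul_apply, smul_eq_mul]
    ring
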